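/- Let $\mathbb{N}^+=\mathbb{N}\setminus\{0\}$ and let $d\ge 2$ be an integer. Let $\Gamma=(U,V,E)$ be a bipartite graph, $E\subseteq U\times V$, whose parts $U$ and $V$ are two disjoint copies of $\mathbb{N}^+$. For $v\in V$ let $u_v\in U$ be the copy of $v$ (the same number), and for $u\in U$ let $v_u\in V$ be the copy of $u$. Assume that 1. $\Gamma$ is locally finite, i.e. every vertex has finitely many neighbours; 2. $E$ contains no edge of the form $(u,v_u)$; 3. $\Gamma$ is fully reflected: whenever $(u,v)\in E$, also $(u_v,v_u)\in E$; 4. $\Gamma$ satisfies Hall's $d$-harem condition: $|N(X)|\ge d|X|$ and $|N(Y)|\ge \frac1d|Y|$ for all finite $X\subseteq U$ and $Y\subseteq V$, where $N(\cdot)$ denotes the set of neighbours. Then $\Gamma$ has a perfect $(1,d-1)$-matching, i.e. a set $M\subseteq E$ such that every $u\in U$ lies in exactly $d-1$ edges of $M$ and every $v\in V$ lies in exactly one edge of $M$, such that the function $f:\mathbb{N}^+\to\mathbb{N}^+$ realized by $M$ (that is, $f(v)=u$ if and only if $(u,v)\in M$), which is $(d-1)$ to $1$ (each fibre has exactly $d-1$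 elements), has controlled sizes of its cycles: (i) $f^2(1)=1$; (ii) if $n\ge 2$ is a periodic point of $f$, then its cycle has length at most $n$, i.e. the least $i\ge 1$ with $f^i(n)=n$ satisfies $i\le n$; (iii) if $n\ge 2$ and $f^i(n)\ne n$ for all $1\le i\le n$, then there are integers $0\le k\le 2n$ and $1\le l\le n$ with $f^{k+l}(n)=f^k(n)$. -/

import Mathlib

/-- A bipartite graph `Γ = (U, V, E)`: the edges join elements of `U` to elements of `V`.
The two parts are separate types (or two copies of the same type), so they are disjoint. -/
structure BipartiteGraph (U V : Type*) where
  /-- the edge set `E ⊆ U × V` -/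
  E : Set (U × V)

namespace BipartiteGraph

/-- The neighbourhood `N(X) ⊆ V` of a set `X ⊆ U`. -/
def nbrsOfLeft {U V : Type*} (G : BipartiteGraph U V) (X : Set U) : Set V :=
  {v | ∃ u ∈ X, (u, v) ∈ G.E}

/-- The neighbourhood `N(Y) ⊆ U` of a set `Y ⊆ V`. -/
def nbrsOfRight {U V : Type*} (G : BipartiteGraph U V) (Y : Set V) : Set U :=
  {u | ∃ v ∈ Y, (u, v) ∈ G.E}

/-- Every vertex, on either side, has finitely many neighbours. -/
def LocallyFinite {U V : Type*} (G : BipartiteGraph U V) : Prop :=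
  (∀ u : U, (G.nbrsOfLeft {u}).Finite) ∧ (∀ v : V, (G.nbrsOfRight {v}).Finite)

/-- Hall's `k`-harem condition (for `k ≥ 1`): `|N(X)| ≥ k |X|` and `|N(Y)| ≥ |Y| / k`
for all finite `X ⊆ U`, `Y ⊆ V`. The second inequality is written without the division. -/
def HallHarem {U V : Type*} (G : BipartiteGraph U V) (k : ℕ) : Prop :=
  (∀ X : Finset U, (k : ℕ∞) * (X.card : ℕ∞) ≤ (G.nbrsOfLeft (X : Set U)).encard) ∧
  (∀ Y : Finset V, (Y.card : ℕ∞) ≤ (k : ℕ∞) * (G.nbrsOfRight (Y : Set V)).encard)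

/-- For a graph whose two parts are copies of the same set `α`:
whenever `(u, v)` is an edge, so is `(u_v, v_u)`, where `u_v` is the left copy of `v`
and `v_u` is the right copy of `u`. -/
def FullyReflected {α : Type*} (G : BipartiteGraph α α) : Prop :=
  ∀ u v : α, (u, v) ∈ G.E → (v, u) ∈ G.E

/-- For a graph whose two parts are copies of the same set `α`:
there is no edge `(u, v_u)` between a vertex and its own copy. -/
def NoCopyEdges {α : Type*} (G : BipartiteGraph α α) : Prop :=
  ∀ u : α, (u, u) ∉ G.E

/-- `M` is a perfect `(1,k)`-matching of `G`: a set of edges in which every `u ∈ U` is joined to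
exactly `k` elements of `V`, and every `v ∈ V` is joined to exactly one element of `U`. -/
structure IsPerfectMatching {U V : Type*} (G : BipartiteGraph U V) (k : ℕ)
    (M : Set (U × V)) : Prop where
  subset_edges : M ⊆ G.E
  left_degree : ∀ u : U, {v : V | (u, v) ∈ M}.encard = (k : ℕ∞)
  right_unique : ∀ v : V, ∃! u : U, (u, v) ∈ M

end BipartiteGraph

/-- The set of edges `M` realizes the function `f`: the edges in `M` are exactly
the pairs `(f v, v)`. -/
def Realizes {U V : Type*} (M : Set (U × V)) (f : V → U) : Prop :=
  ∀ (u : U) (v : V), (u, v) ∈ M ↔ f v = u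

/-- `f` is a `k` to `1` function: every fibre has exactly `k` elements. -/
def IsKToOne {U V : Type*} (k : ℕ) (f : V → U) : Prop :=
  ∀ u : U, (f ⁻¹' {u}).encard = (k : ℕ∞)

/-- A function on the positive integers has controlled sizes of its cycles. The length of the cycle
through a periodic point `n` is the least `i ≥ 1` with `f^i(n) = n`, i.e.
`Function.minimalPeriod f n`. -/
structure ControlledCycleSizes (f : ℕ+ → ℕ+) : Prop where
  one : f^[2] 1 = 1
  cycle_length : ∀ n : ℕ+, 2 ≤ n → n ∈ Function.periodicPts f →
    Function.minimalPeriod f n ≤ (n : ℕ)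
  reach_cycle : ∀ n : ℕ+, 2 ≤ n →
    (∀ i : ℕ, 1 ≤ i → i ≤ (n : ℕ) → f^[i] n ≠ n) →
    ∃ k l : ℕ, k ≤ 2 * (n : ℕ) ∧ 1 ≤ l ∧ l ≤ (n : ℕ) ∧ f^[k + l] n = f^[k] n

/-!
Hall's marriage theorem, applied to `d` copies of each left vertex, assigns to the vertices `u`
pairwise disjoint sets `C u` of `d` neighbours, the *children* of `u`; the *parent* map `g` sends a
child to its owner. Following parents wherever possible would give a `d`-to-one partial function,
so every vertex has one child to spare, and this is spent on closing short cycles.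

The choice of the spare child is governed by a rank `ρ` (`exists_rank`): `ρ v` is `0` if `v` is
`g`-periodic and is otherwise the least number whose forward `g`-orbit meets `v`. Then `ρ v ≤ v`,
and each `u` has at most one child `v` with `ρ v ≤ ρ u`, because descendant sets of distinct
children of a non-periodic vertex are disjoint. Let `a u` be a child such that all the others have
rank above `ρ u`, and let `b u` be a second child.

Roots (`IsRoot`) are the vertices without a parent, the children `a u`, and the vertices `b (b u)`
with `u` a root. The map `rewire` sends a root `v` to its child `b v`, and any other vertex to its
parent. If `v` is a root, then `b v` is not (`IsRoot.not_isRoot`), so `v` and `b v` form a cycle of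
length two; the extra preimage `v` of `b v` is compensated by `b v` losing both of its children
`a (b v)` and `b (b v)`, so all fibres have `d - 1` elements (`encard_rewire_fiber`). A vertex that
is not a root moves to a vertex of smaller rank, so `n` arrives at a root after at most `ρ n ≤ n`
steps (`exists_rewire_iterate_add_two`). In particular all cycles have length at most two.
Finally `b` is chosen with `b u = 1` whenever `1` is a child of `u` other than `a u`, which puts
`1` itself on a cycle.
-/

/-! ### Disjoint sets of children -/

/-- The `d`-fold version of Hall's marriage theorem, for the left part of a bipartite graph. -/
theorem BipartiteGraph.HallHarem.exists_children {U V : Type*} {G : BipartiteGraph U V} {d : ℕ}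
    (hHall : G.HallHarem d) (hfin : G.LocallyFinite) :
    ∃ C : U → Finset V, (∀ u, (C u).card = d) ∧ (∀ u, ∀ v ∈ C u, (u, v) ∈ G.E) ∧
      ∀ u u' v, v ∈ C u → v ∈ C u' → u = u' := by
  classical
  let t : U × Fin d → Finset V := fun p => (hfin.1 p.1).toFinset
  have ht : ∀ p v, v ∈ t p ↔ (p.1, v) ∈ G.E := fun p v => by
    simp [t, BipartiteGraph.nbrsOfLeft]
  obtain ⟨h, hinj, hmem⟩ := (Finset.all_card_le_biUnion_card_iff_exists_injective t).1 (by
    intro s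
    let X := s.image Prod.fst
    have h1 : s.card ≤ d * X.card := by
      calc s.card ≤ (X ×ˢ (Finset.univ : Finset (Fin d))).card :=
            Finset.card_le_card fun p hp =>
              Finset.mem_product.2 ⟨Finset.mem_image_of_mem _ hp, Finset.mem_univ _⟩
        _ = d * X.card := by simp [Finset.card_product, mul_comm]
    have h2 : G.nbrsOfLeft (X : Set U) = (s.biUnion t : Finset V) := by
      ext v
      simp only [BipartiteGraph.nbrsOfLeft, Set.mem_ofPred_eq, Finset.mem_coe, Finset.mem_biUnion,
        ht, X, Finset.mem_image]
      constructor
      · rintro ⟨u, ⟨p, hp, rfl⟩, huv⟩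
        exact ⟨p, hp, huv⟩
      · rintro ⟨p, hp, huv⟩
        exact ⟨p.1, ⟨p, hp, rfl⟩, huv⟩
    have h3 := hHall.1 X
    rw [h2, Set.encard_coe_eq_coe_finsetCard] at h3
    exact h1.trans (by exact_mod_cast h3))
  refine ⟨fun u => Finset.univ.image fun i => h (u, i), fun u => ?_, ?_, ?_⟩
  · rw [Finset.card_image_of_injective, Finset.card_univ, Fintype.card_fin]
    intro i j hij
    exact (Prod.mk.inj (hinj hij)).2
  · intro u v hv
    obtain ⟨i, -, rfl⟩ := Finset.mem_image.1 hv
    exact (ht _ _).1 (hmem (u, i))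
  · intro u u' v hv hv'
    obtain ⟨i, -, rfl⟩ := Finset.mem_image.1 hv
    obtain ⟨j, -, hj⟩ := Finset.mem_image.1 hv'
    exact (Prod.mk.inj (hinj hj)).1.symm

/-! ### The rank of a self-map of the positive integers -/

/-- Every self-map `g` of `ℕ+` has a rank, bounded by the identity, that increases strictly from a
point to all but at most one of its preimages. -/
theorem exists_rank (g : ℕ+ → ℕ+) :
    ∃ ρ : ℕ+ → ℕ, (∀ v, ρ v ≤ v) ∧
      ∀ v w, g v = g w → ρ v ≤ ρ (g v) → ρ w ≤ ρ (g v) → v = w := by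
  classical
  let S : ℕ+ → Set ℕ := fun v => {m | ∃ n : ℕ+, (n : ℕ) = m ∧ ∃ i, g^[i] n = v}
  let ρ : ℕ+ → ℕ := fun v => if v ∈ Function.periodicPts g then 0 else sInf (S v)
  have hself : ∀ v : ℕ+, (v : ℕ) ∈ S v := fun v => ⟨v, rfl, 0, rfl⟩
  have hper : ∀ v, v ∈ Function.periodicPts g → ρ v = 0 := fun v hv => if_pos hv
  have hnper : ∀ v, v ∉ Function.periodicPts g → ρ v = sInf (S v) := fun v hv => if_neg hv
  have hle : ∀ v, ρ v ≤ sInf (S v) := by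
    intro v
    by_cases hv : v ∈ Function.periodicPts g
    · simp [hper v hv]
    · exact (hnper v hv).le
  have hattain : ∀ v, v ∉ Function.periodicPts g → ∃ n : ℕ+, (n : ℕ) = ρ v ∧ ∃ i, g^[i] n = v := by
    intro v hv
    rw [hnper v hv]
    exact Nat.sInf_mem (⟨_, hself v⟩ : (S v).Nonempty)
  have hzero : ∀ v, ρ v = 0 → v ∈ Function.periodicPts g := by
    intro v h0
    by_contra hv
    obtain ⟨n, hn, -⟩ := hattain v hv
    have := n.pos
    omega
  refine ⟨ρ, fun v => (hle v).trans (Nat.sInf_le (hself v)), ?_⟩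
  intro v w hvw hv hw
  by_cases hu : g v ∈ Function.periodicPts g
  · -- a periodic point has only one periodic preimage
    rw [hper _ hu] at hv hw
    exact (Function.bijOn_periodicPts g).injOn (hzero v (by omega)) (hzero w (by omega)) hvw
  · have key : ∀ x, g x = g v → ρ x ≤ ρ (g v) → ∃ n : ℕ+, (n : ℕ) = ρ (g v) ∧ ∃ i, g^[i] n = x := by
      intro x hx hxle
      have hxn : x ∉ Function.periodicPts g := by
        rintro ⟨p, hp, hpx⟩
        refine hu ⟨p, hp, ?_⟩
        rw [← hx]
        exact hpx.apply
      obtain ⟨n, hn, i, hi⟩ := hattain x hxn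
      have : ρ (g v) ≤ n := (hle _).trans (Nat.sInf_le ⟨n, rfl, i + 1, by
        rw [Function.iterate_succ_apply', hi, hx]⟩)
      exact ⟨n, by omega, i, hi⟩
    -- two distinct preimages on the orbit of one point would make `g v` periodic
    have aux : ∀ (n : ℕ+) (x y : ℕ+) (i j : ℕ), g x = g v → g y = g v → g^[i] n = x →
        g^[j] n = y → i ≤ j → x = y := by
      intro n x y i j hx hy hi hj hij
      obtain ⟨l, rfl⟩ := Nat.exists_eq_add_of_le hij
      rw [add_comm, Function.iterate_add_apply, hi] at hj
      rcases l with _ | l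
      · exact hj
      · refine absurd ⟨l + 1, l.succ_pos, ?_⟩ hu
        change g^[l + 1] (g v) = g v
        rw [← hx, ← Function.iterate_succ_apply, Function.iterate_succ_apply', hj, hy, hx]
    obtain ⟨n, hn, i, hi⟩ := key v rfl hv
    obtain ⟨n', hn', j, hj⟩ := key w hvw.symm hw
    obtain rfl : n = n' := PNat.coe_injective (hn.trans hn'.symm)
    rcases le_total i j with h | h
    · exact aux n v w i j rfl hvw.symm hi hj h
    · exact (aux n w v j i hvw.symm rfl hj hi h).symm

/-! ### Roots and the rewired map -/

/-- The roots of a system of children `C` with two chosen children `a u`, `b u` of each `u`: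
the vertices that are nobody's child, the children `a u`, and `b (b u)` for each root `u`. -/
inductive IsRoot {α : Type*} (C : α → Finset α) (a b : α → α) : α → Prop
  | orphan {v : α} : (∀ u, v ∉ C u) → IsRoot C a b v
  | first (u : α) : IsRoot C a b (a u)
  | grandchild {u : α} : IsRoot C a b u → IsRoot C a b (b (b u))

open Classical in
/-- The map that sends a root `v` to its child `b v`, and any other vertex to its parent. -/
noncomputable def rewire {α : Type*} (C : α → Finset α) (g a b : α → α) (v : α) : α :=
  if IsRoot C a b v then b v else g v

section Rewire

variable {α : Type*} {C : α → Finset α} {g a b : α → α} {ρ : α → ℕ}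

theorem rewire_of_isRoot {v : α} (h : IsRoot C a b v) : rewire C g a b v = b v :=
  if_pos h

theorem rewire_of_not_isRoot {v : α} (h : ¬ IsRoot C a b v) : rewire C g a b v = g v :=
  if_neg h

theorem mem_parent_of_not_isRoot (hg : ∀ u, ∀ v ∈ C u, g v = u) {v : α}
    (h : ¬ IsRoot C a b v) : v ∈ C (g v) := by
  by_contra hv
  refine h (.orphan fun u hu => hv ?_)
  rwa [hg u v hu]

/-- The vertices `v` and `b v` cannot both be roots: otherwise `v = b w` for a root `w` of smaller
rank, and the argument repeats with `w` and `b w = v`. -/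
theorem IsRoot.not_isRoot (hg : ∀ u, ∀ v ∈ C u, g v = u) (ha : ∀ u, a u ∈ C u)
    (hb : ∀ u, b u ∈ C u) (hab : ∀ u, b u ≠ a u)
    (hρ : ∀ u, ∀ v ∈ C u, v ≠ a u → ρ u < ρ v) {v : α} (hv : IsRoot C a b v) :
    ¬ IsRoot C a b (b v) := by
  induction hn : ρ v using Nat.strong_induction_on generalizing v with
  | _ n ih =>
    intro hbv
    generalize hx : b v = x at hbv
    cases hbv with
    | orphan h => exact h v (hx ▸ hb v)
    | first u =>
      have huv : v = u := by rw [← hg v _ (hb v), hx, hg u _ (ha u)]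
      subst huv
      exact hab v hx
    | @grandchild u hu =>
      have huv : v = b u := by rw [← hg v _ (hb v), hx, hg _ _ (hb (b u))]
      subst huv
      exact ih _ (hn ▸ hρ u _ (hb u) (hab u)) hu rfl hv

theorem rewire_rewire_of_isRoot (hg : ∀ u, ∀ v ∈ C u, g v = u) (ha : ∀ u, a u ∈ C u)
    (hb : ∀ u, b u ∈ C u) (hab : ∀ u, b u ≠ a u)
    (hρ : ∀ u, ∀ v ∈ C u, v ≠ a u → ρ u < ρ v) {v : α} (hv : IsRoot C a b v) :
    rewire C g a b (rewire C g a b v) = v := by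
  rw [rewire_of_isRoot hv, rewire_of_not_isRoot (hv.not_isRoot hg ha hb hab hρ), hg v _ (hb v)]

theorem rank_lt_of_not_isRoot (hg : ∀ u, ∀ v ∈ C u, g v = u)
    (hρ : ∀ u, ∀ v ∈ C u, v ≠ a u → ρ u < ρ v) {v : α} (hv : ¬ IsRoot C a b v) :
    ρ (g v) < ρ v :=
  hρ _ v (mem_parent_of_not_isRoot hg hv) fun h => hv (h ▸ .first _)

/-- Every vertex `v` arrives at a cycle of length at most two after at most `ρ v`
steps. -/
theorem exists_rewire_iterate_add_two (hg : ∀ u, ∀ v ∈ C u, g v = u) (ha : ∀ u, a u ∈ C u)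
    (hb : ∀ u, b u ∈ C u) (hab : ∀ u, b u ≠ a u)
    (hρ : ∀ u, ∀ v ∈ C u, v ≠ a u → ρ u < ρ v) (v : α) :
    ∃ k ≤ ρ v, (rewire C g a b)^[k + 2] v = (rewire C g a b)^[k] v := by
  induction hn : ρ v using Nat.strong_induction_on generalizing v with
  | _ n ih =>
    by_cases hv : IsRoot C a b v
    · exact ⟨0, Nat.zero_le _, rewire_rewire_of_isRoot hg ha hb hab hρ hv⟩
    · have hlt := rank_lt_of_not_isRoot hg hρ hv
      obtain ⟨k, hk, h⟩ := ih _ (hn ▸ hlt) (g v) rfl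
      refine ⟨k + 1, by omega, ?_⟩
      rw [add_right_comm, Function.iterate_succ_apply _ (k + 2), Function.iterate_succ_apply _ k,
        rewire_of_not_isRoot hv, h]

theorem encard_rewire_fiber (hg : ∀ u, ∀ v ∈ C u, g v = u) (ha : ∀ u, a u ∈ C u)
    (hb : ∀ u, b u ∈ C u) (hab : ∀ u, b u ≠ a u) {d : ℕ} (hd : ∀ u, (C u).card = d) (u : α) :
    (rewire C g a b ⁻¹' {u}).encard = ((d - 1 : ℕ) : ℕ∞) := by
  classical
  have hchild : ∀ v ∈ C u, IsRoot C a b v →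
      v = a u ∨ v = b u ∧ ∃ w, IsRoot C a b w ∧ b w = u := by
    intro v hv hr
    have hgv := hg u v hv
    cases hr with
    | orphan h => exact absurd hv (h u)
    | first w =>
      rw [hg w _ (ha w)] at hgv
      exact .inl (hgv ▸ rfl)
    | @grandchild w hw =>
      rw [hg _ _ (hb (b w))] at hgv
      exact .inr ⟨hgv ▸ rfl, w, hw, hgv⟩
  by_cases hu : ∃ w, IsRoot C a b w ∧ b w = u
  · obtain ⟨w, hw, hwu⟩ := hu
    have hset : rewire C g a b ⁻¹' {u} = (insert w (((C u).erase (a u)).erase (b u)) : Finset α) := by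
      ext v
      simp only [Set.mem_preimage, Set.mem_singleton_iff, Finset.mem_coe, Finset.mem_insert,
        Finset.mem_erase]
      constructor
      · intro h
        by_cases hv : IsRoot C a b v
        · rw [rewire_of_isRoot hv] at h
          left
          rw [← hg v _ (hb v), h, ← hwu, hg w _ (hb w)]
        · rw [rewire_of_not_isRoot hv] at h
          refine .inr ⟨?_, ?_, h ▸ mem_parent_of_not_isRoot hg hv⟩
          · rintro rfl
            exact hv (hwu ▸ .grandchild hw)
          · rintro rfl
            exact hv (.first _)
      · rintro (rfl | ⟨hvb, hva, hv⟩)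
        · rw [rewire_of_isRoot hw, hwu]
        · rw [rewire_of_not_isRoot, hg u v hv]
          intro hr
          rcases hchild v hv hr with h | h
          · exact hva h
          · exact hvb h.1
    have hw' : w ∉ ((C u).erase (a u)).erase (b u) := by
      intro h
      simp only [Finset.mem_erase] at h
      rcases hchild w h.2.2 hw with h' | h'
      · exact h.2.1 h'
      · exact h.1 h'.1
    have hb' : b u ∈ (C u).erase (a u) := Finset.mem_erase.2 ⟨hab u, hb u⟩
    rw [hset, Set.encard_coe_eq_coe_finsetCard, Finset.card_insert_of_notMem hw',
      Finset.card_erase_add_one hb', Finset.card_erase_of_mem (ha u), hd]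
  · have hset : rewire C g a b ⁻¹' {u} = ((C u).erase (a u) : Finset α) := by
      ext v
      simp only [Set.mem_preimage, Set.mem_singleton_iff, Finset.mem_coe, Finset.mem_erase]
      constructor
      · intro h
        by_cases hv : IsRoot C a b v
        · rw [rewire_of_isRoot hv] at h
          exact absurd ⟨v, hv, h⟩ hu
        · rw [rewire_of_not_isRoot hv] at h
          refine ⟨?_, h ▸ mem_parent_of_not_isRoot hg hv⟩
          rintro rfl
          exact hv (.first _)
      · rintro ⟨hva, hv⟩
        rw [rewire_of_not_isRoot, hg u v hv]
        intro hr
        rcases hchild v hv hr with h | h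
        · exact hva h
        · exact hu h.2
    rw [hset, Set.encard_coe_eq_coe_finsetCard, Finset.card_erase_of_mem (ha u), hd]

end Rewire

/-! ### Matchings and cycle sizes -/

/-- A self-map of `ℕ+` whose points all arrive at a cycle of length at most two early enough has
controlled cycle sizes. -/
theorem ControlledCycleSizes.of_iterate_add_two {f : ℕ+ → ℕ+} (h1 : f^[2] 1 = 1)
    (h : ∀ n : ℕ+, ∃ k ≤ (n : ℕ), f^[k + 2] n = f^[k] n) : ControlledCycleSizes f where
  one := h1
  cycle_length n hn hper := by
    obtain ⟨k, -, hk⟩ := h n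
    have hn2 : 2 ≤ (n : ℕ) := hn
    refine le_trans (Function.IsPeriodicPt.minimalPeriod_le two_pos ?_) hn2
    have hp : f^[2] n ∈ Function.periodicPts f := by
      obtain ⟨p, hp, hpn⟩ := hper
      exact ⟨p, hp, hpn.apply_iterate 2⟩
    -- iterates of `f` are injective on periodic points
    have hinj : Set.InjOn f^[k] (Function.periodicPts f) :=
      ((Function.bijOn_periodicPts f).iterate k).injOn
    refine hinj hp hper ?_
    rw [← Function.iterate_add_apply, hk]
  reach_cycle n hn _ := by
    obtain ⟨k, hk, hkn⟩ := h n
    exact ⟨k, 2, by omega, by omega, hn, hkn⟩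

theorem theorem2p3 (d : ℕ) (hd : 2 ≤ d) (G : BipartiteGraph ℕ+ ℕ+)
    (hfin : G.LocallyFinite) (hloop : G.NoCopyEdges) (hrefl : G.FullyReflected)
    (hHall : G.HallHarem d) :
    ∃ (M : Set (ℕ+ × ℕ+)) (f : ℕ+ → ℕ+),
      G.IsPerfectMatching (d - 1) M ∧ Realizes M f ∧ IsKToOne (d - 1) f ∧
        ControlledCycleSizes f := by
  classical
  obtain ⟨C, hcard, hE, hdisj⟩ := hHall.exists_children hfin
  have hparent : ∀ v, ∃ u, ∀ u', v ∈ C u' → u = u' := by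
    intro v
    by_cases h : ∃ u, v ∈ C u
    · obtain ⟨u, hu⟩ := h
      exact ⟨u, fun u' hu' => hdisj u u' v hu hu'⟩
    · push Not at h
      exact ⟨v, fun u' hu' => absurd hu' (h u')⟩
  choose g hg' using hparent
  have hg : ∀ u, ∀ v ∈ C u, g v = u := fun u v hv => hg' v u hv
  obtain ⟨ρ, hρle, hρuniq⟩ := exists_rank g
  have hfirst : ∀ u, ∃ x ∈ C u, ∀ v ∈ C u, v ≠ x → ρ u < ρ v := by
    intro u
    by_cases h : ∃ x ∈ C u, ρ x ≤ ρ u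
    · obtain ⟨x, hx, hxu⟩ := h
      refine ⟨x, hx, fun v hv hvx => ?_⟩
      by_contra! hle
      have h1 := hg u v hv
      have h2 := hg u x hx
      exact hvx (hρuniq v x (h1.trans h2.symm) (by rwa [h1]) (by rwa [h1]))
    · push Not at h
      obtain ⟨x, hx⟩ := Finset.card_pos.1 (by rw [hcard u]; omega : 0 < (C u).card)
      exact ⟨x, hx, fun v hv _ => h v hv⟩
  choose a ha hρ using hfirst
  have hsecond : ∀ u, ∃ y ∈ C u, y ≠ a u ∧ (1 ∈ C u → 1 ≠ a u → y = 1) := by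
    intro u
    by_cases h : 1 ∈ C u ∧ 1 ≠ a u
    · exact ⟨1, h.1, h.2, fun _ _ => rfl⟩
    · obtain ⟨y, hy, hya⟩ := Finset.exists_mem_ne (by rw [hcard u]; omega : 1 < (C u).card) (a u)
      exact ⟨y, hy, hya, fun h1 h2 => absurd ⟨h1, h2⟩ h⟩
  choose b hb hab hb1 using hsecond
  have hfib := encard_rewire_fiber hg ha hb hab hcard
  refine ⟨{p | rewire C g a b p.2 = p.1}, rewire C g a b, ⟨?_, hfib, ?_⟩,
    fun _ _ => Iff.rfl, hfib, .of_iterate_add_two ?_ fun n => ?_⟩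
  · rintro ⟨u, v⟩ (rfl : rewire C g a b v = u)
    by_cases hv : IsRoot C a b v
    · rw [rewire_of_isRoot hv]
      exact hrefl _ _ (hE v _ (hb v))
    · rw [rewire_of_not_isRoot hv]
      exact hE _ v (mem_parent_of_not_isRoot hg hv)
  · intro v
    refine ⟨rewire C g a b v, ?_, ?_⟩
    · change rewire C g a b v = rewire C g a b v
      rfl
    · rintro u (rfl : rewire C g a b v = u)
      rfl
  · by_cases h1 : IsRoot C a b 1
    · exact rewire_rewire_of_isRoot hg ha hb hab hρ h1
    · -- the parent of `1` has rank `0`, so it is a root, and `1` is its chosen child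
      have hlt := rank_lt_of_not_isRoot hg hρ h1
      have hle := hρle 1
      rw [PNat.one_coe] at hle
      have hr : IsRoot C a b (g 1) := by
        by_contra hr
        have := rank_lt_of_not_isRoot hg hρ hr
        omega
      have hb' : b (g 1) = 1 :=
        hb1 _ (mem_parent_of_not_isRoot hg h1) fun h => h1 (h ▸ .first _)
      change rewire C g a b (rewire C g a b 1) = 1
      rw [rewire_of_not_isRoot h1, rewire_of_isRoot hr, hb']
  · obtain ⟨k, hk, h⟩ := exists_rewire_iterate_add_two hg ha hb hab hρ n
    exact ⟨k, hk.trans (hρle n), h⟩
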